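/- Let $n\ge 1$. On $n$ qubits let $\sigma^x_u,\sigma^z_u$ be the Pauli operators on qubit $u$, and let $H=n^{-1}H_{\mathrm{Ising}}$ with $H_{\mathrm{Ising}}=\sum_{u<v}\sigma^z_u\sigma^z_v$. Let $C=\sum_{u<v}c_{uv}\sigma^z_u\sigma^z_v$ and $C'=\sum_{u<v}c'_{uv}\sigma^z_u\sigma^z_v$ with real symmetric weights $c_{uv},c'_{uv}$. A compilation of $C'$ is a finite sequence of bit flips $\sigma^x_u$ and pulses, where a pulse $p$ with sign $s_p\in\{\pm1\}$ and duration $\tau_p\ge 0$ is an evolution for time $\tau_p$ under $s_pH$, such that every qubit is flipped an even number of times in total and $$C'=\sum_p s_p\,\tau_p\, n^{-1}\sum_{u<v}(-1)^{\mathbf 1_{S_p}(u)+\mathbf 1_{S_p}(v)}\sigma^z_u\sigma^z_v ,$$ where $S_p$ is the set of qubits that have been flipped an odd number of times before pulse $p$. (The sequences of pulses and bit flips produced by the union-of-stars algorithm are compilations in this sense.) Its total time is $T=\sum_p\tau_p$. Fix a compilation of $C'$, a dephasing rate $\Gamma\ge 0$, and angles $\gamma\ge 0$ and $\beta\in\mathbb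 R$, and put $t=\gamma T$. Single-layer QAOA starts in $|+\rangle^{\otimes n}$, executes the compilation with every pulse duration multiplied by $\gamma$, and then applies the noiseless unitary $e^{-i\beta B}$, $B=\sum_u\sigma^x_u$. Bit flips are instantaneous and noiseless, $\rho\mapsto\sigma^x_u\rho\,\sigma^x_u$; during a pulse of sign $s$ the density matrix follows the master equation $$\frac{d\rho}{dt}=-i\,s\,(H\rho-\rho H)-\sum_u\left(J_uJ_u^\dagger\rho-2J_u\rho J_u^\dagger+\rho J_uJ_u^\dagger\right),\qquad J_u=\sqrt{\Gamma/8}\;\sigma^z_u .$$ Then the final density matrix $\rho$ exists and is unique, and $\langle C\rangle=\operatorname{Tr}(C\rho)$ is $$\begin{aligned}\langle C\rangle={}&\sum_{u<v}\frac{c_{uv}\sin(4\beta)\sin(2\gamma c'_{uv})\,e^{-\Gamma t/2}}{2}\left(\prod_{\mu\ne u,v}\cos(2\gamma c'_{\mu v})+\prod_{\mu\ne u,v}\cos(2\gamma c'_{\mu u})\right)\\&-\sum_{u<v}\frac{c_{uv}\sin^2(2\beta)\,e^{-\Gamma t}}{2}\left(\prod_{\mu\ne u,v}\cos\bigl(2\gamma(c'_{\mu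 u}+c'_{\mu v})\bigr)-\prod_{\mu\ne u,v}\cos\bigl(2\gamma(c'_{\mu u}-c'_{\mu v})\bigr)\right).\end{aligned}$$ -/

import Mathlib

open scoped NNReal Matrix

noncomputable section

namespace DephasedQAOA

/-- Operators on `n` qubits, as matrices in the computational basis `|z⟩`, `z : Fin n → Fin 2`. -/
abbrev Operator (n : ℕ) : Type := Matrix (Fin n → Fin 2) (Fin n → Fin 2) ℂ

/-- The single-qubit operator `A` acting on qubit `u`, tensored with the identity elsewhere. -/
def onQubit {n : ℕ} (A : Matrix (Fin 2) (Fin 2) ℂ) (u : Fin n) : Operator n :=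
  Matrix.of fun z w => if ∀ v, v ≠ u → z v = w v then A (z u) (w u) else 0

/-- Pauli `X` on qubit `u`. -/
def sigmaX {n : ℕ} (u : Fin n) : Operator n := onQubit !![0, 1; 1, 0] u

/-- Pauli `Z` on qubit `u`. -/
def sigmaZ {n : ℕ} (u : Fin n) : Operator n := onQubit !![1, 0; 0, -1] u

/-- The graph coupling operator `∑_{u<v} c_{uv} Z_u Z_v`. The weight of an unordered pair that is
not an edge is `0`; weights of diagonal pairs are not used. -/
def couplingOp {n : ℕ} (c : Sym2 (Fin n) → ℝ) : Operator n :=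
  ∑ u : Fin n, ∑ v ∈ Finset.Ioi u, (c s(u, v) : ℂ) • (sigmaZ u * sigmaZ v)

/-- `H_Ising = ∑_{u<v} Z_u Z_v`. -/
def isingOp (n : ℕ) : Operator n :=
  ∑ u : Fin n, ∑ v ∈ Finset.Ioi u, sigmaZ u * sigmaZ v

/-- The native Hamiltonian `H = n⁻¹ H_Ising`. -/
def nativeH (n : ℕ) : Operator n := (n : ℂ)⁻¹ • isingOp n

/-- `H_Ising` with the sign of `Z_u` changed for all `u ∈ S`. -/
def flippedIsingOp {n : ℕ} (S : Finset (Fin n)) : Operator n :=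
  ∑ u : Fin n, ∑ v ∈ Finset.Ioi u,
    ((-1 : ℂ) ^ ((if u ∈ S then 1 else 0) + (if v ∈ S then 1 else 0))) • (sigmaZ u * sigmaZ v)

/-! ### Compilations -/

/-- The elementary operations of a compilation: a bit flip of one qubit, or a global pulse of
duration `τ` under the Hamiltonian `s H`, where the sign `s = ±1` can be chosen. -/
inductive Op (n : ℕ) : Type
  | flip (u : Fin n) : Op n
  | pulse (s : ℤˣ) (τ : ℝ≥0) : Op n

/-- Sequences of operations; the head of the list is executed first. -/
abbrev Program (n : ℕ) : Type := List (Op n)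

/-- The set of qubits flipped an odd number of times, starting from `S`. -/
def netFlips {n : ℕ} : Finset (Fin n) → Program n → Finset (Fin n)
  | S, [] => S
  | S, Op.flip u :: P => netFlips (symmDiff S {u}) P
  | S, Op.pulse _ _ :: P => netFlips S P

/-- The coupling operator accumulated by a program when the qubits in `S` are currently flipped:
a pulse of sign `s` and duration `τ` adds
`s τ n⁻¹ ∑_{u<v} (-1)^(1_S(u) + 1_S(v)) Z_u Z_v`. -/
def accumulated {n : ℕ} : Finset (Fin n) → Program n → Operator n
  | _, [] => 0
  | S, Op.flip u :: P => accumulated (symmDiff S {u}) P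
  | S, Op.pulse s τ :: P =>
      (((s : ℤ) : ℂ) * ((τ : ℝ) : ℂ) * (n : ℂ)⁻¹) • flippedIsingOp S + accumulated S P

/-- `P` is a graph compilation of the coupling `C' = ∑_{u<v} c'_{uv} Z_u Z_v`: all bit flips are
undone at the end, and the accumulated coupling operator is `C'`. -/
def Compiles {n : ℕ} (P : Program n) (c' : Sym2 (Fin n) → ℝ) : Prop :=
  netFlips ∅ P = ∅ ∧ accumulated ∅ P = couplingOp c'

/-- The total time of a program, i.e. the sum of the durations of its pulses. -/
def totalTime {n : ℕ} : Program n → ℝ≥0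
  | [] => 0
  | Op.flip _ :: P => totalTime P
  | Op.pulse _ τ :: P => τ + totalTime P

/-- The program in which the duration of every pulse is multiplied by `γ`. -/
def scale {n : ℕ} (γ : ℝ≥0) : Program n → Program n
  | [] => []
  | Op.flip u :: P => Op.flip u :: scale γ P
  | Op.pulse s τ :: P => Op.pulse s (γ * τ) :: scale γ P

/-! ### Noisy execution -/

/-- The jump operator `J_u = √(Γ/8) Z_u`. -/
def jump {n : ℕ} (Γ : ℝ) (u : Fin n) : Operator n := (Real.sqrt (Γ / 8) : ℂ) • sigmaZ u

/-- The right-hand side of the dephasing master equation,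
`-i (H ρ - ρ H) - ∑_u (J_u J_u† ρ - 2 J_u ρ J_u† + ρ J_u J_u†)`. -/
def lindbladian {n : ℕ} (Γ : ℝ) (H ρ : Operator n) : Operator n :=
  -(Complex.I • (H * ρ - ρ * H)) -
    ∑ u : Fin n, (jump Γ u * (jump Γ u)ᴴ * ρ - (2 : ℂ) • (jump Γ u * ρ * (jump Γ u)ᴴ)
      + ρ * (jump Γ u * (jump Γ u)ᴴ))

/-- `r` solves the master equation with Hamiltonian `H` on the time interval `[0, T]`
(the derivative of a matrix-valued curve is taken entrywise). -/
def SolvesMasterEquation {n : ℕ} (Γ : ℝ) (H : Operator n) (T : ℝ) (r : ℝ → Operator n) : Prop :=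
  ∀ s ∈ Set.Icc 0 T, ∀ z w,
    HasDerivWithinAt (fun x => r x z w) (lindbladian Γ H (r s) z w) (Set.Icc 0 T) s

/-- `Executes Γ P ρ ρ'`: running `P` from the state `ρ` ends in the state `ρ'`. Bit flips are
instantaneous and noiseless; during a pulse the state follows the master equation. -/
def Executes {n : ℕ} (Γ : ℝ) : Program n → Operator n → Operator n → Prop
  | [], ρ, ρ' => ρ' = ρ
  | Op.flip u :: P, ρ, ρ' => Executes Γ P (sigmaX u * ρ * (sigmaX u)ᴴ) ρ'
  | Op.pulse s τ :: P, ρ, ρ' => ∃ r : ℝ → Operator n,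
      SolvesMasterEquation Γ (((s : ℤ) : ℂ) • nativeH n) τ r ∧ r 0 = ρ ∧ Executes Γ P (r τ) ρ'

/-! ### Single-layer QAOA -/

/-- The state vector `|+⟩^{⊗n}`. -/
def plusVec (n : ℕ) : (Fin n → Fin 2) → ℂ := fun _ => ∏ _i : Fin n, ((Real.sqrt 2 : ℂ))⁻¹

/-- The density matrix of `|+⟩^{⊗n}`. -/
def plusState (n : ℕ) : Operator n := Matrix.vecMulVec (plusVec n) (star (plusVec n))

/-- The mixer `e^{-iβB}`, `B = ∑_u X_u`. -/
def mixer (n : ℕ) (β : ℝ) : Operator n :=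
  NormedSpace.exp ((-(Complex.I * (β : ℂ))) • ∑ u : Fin n, (sigmaX u : Operator n))

/-- `ρ` is an output state of single-layer QAOA with angles `γ, β`, where the phase unitary
`e^{-iγC'}` is executed by the `γ`-scaled version of the program `P` with dephasing rate `Γ`. -/
def IsQAOAOutput {n : ℕ} (Γ : ℝ) (P : Program n) (γ : ℝ≥0) (β : ℝ) (ρ : Operator n) : Prop :=
  ∃ σ, Executes Γ (scale γ P) (plusState n) σ ∧ ρ = mixer n β * σ * (mixer n β)ᴴ

/-- The expectation value `Tr(A ρ)` of `A` in the state `ρ`. -/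
def expectation {n : ℕ} (A ρ : Operator n) : ℂ := (A * ρ).trace

end DephasedQAOA

end

open scoped NNReal Matrix

noncomputable section

namespace DephasedQAOA

/-! In the computational basis the Hamiltonian and all jump operators are diagonal, so the master
equation decouples into one scalar linear ODE per matrix entry, and bit flips only permute the
entries. The final state is therefore explicit, which settles existence and uniqueness: before the
mixer, entry `(z, w)` is `2⁻ⁿ` times a phase given by the difference of the `C'`-energies of `z` and
`w` and a damping given by the number of bits where they differ (`executes_scale_iff`,
`isQAOAOutput_iff`).

The mixer is moved onto the observable: it turns `Z_u` into `(cos 2β + i sin 2β X_u) Z_u`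
(`mixer_conj_sigmaZ`). Hence `⟨Z_u Z_v⟩` is a combination of sums over `z` of the entries at `(z,
flipSet S z)` with `S = ∅, {u}, {v}, {u, v}`. On such entries the damping depends only on `S.card`,
and the energy difference is linear in the spins outside `S`. Once the bits of `u` and `v` are
fixed, the sum factorises over the other qubits (`sum_mul_prod_compl_pair`), and each contributes a
cosine. -/

variable {n : ℕ}

/-! ### Spins and bit flips of basis states -/

/-- The eigenvalue of Pauli `Z` on a basis state of one qubit. -/
def spin (b : Fin 2) : ℝ := if b = 0 then 1 else -1

@[simp] theorem spin_zero : spin 0 = 1 := rfl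

@[simp] theorem spin_one : spin 1 = -1 := rfl

theorem spin_add_one (b : Fin 2) : spin (b + 1) = -spin b := by
  fin_cases b <;> simp [spin]

theorem spin_mul_self (b : Fin 2) : spin b * spin b = 1 := by
  fin_cases b <;> simp

/-- The basis state `z` with the qubits in `S` flipped. -/
def flipSet (S : Finset (Fin n)) (z : Fin n → Fin 2) : Fin n → Fin 2 :=
  fun u => if u ∈ S then z u + 1 else z u

@[simp] theorem flipSet_empty (z : Fin n → Fin 2) : flipSet ∅ z = z := by
  ext u; simp [flipSet]

theorem flipSet_flipSet (S R : Finset (Fin n)) (z : Fin n → Fin 2) :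
    flipSet S (flipSet R z) = flipSet (symmDiff S R) z := by
  have h (b : Fin 2) : b + 1 + 1 = b := by fin_cases b <;> rfl
  funext u
  by_cases hS : u ∈ S <;> by_cases hR : u ∈ R <;>
    simp [flipSet, Finset.mem_symmDiff, hS, hR, h]

theorem flipSet_involutive (S : Finset (Fin n)) : Function.Involutive (flipSet S) := by
  intro z
  simp [flipSet_flipSet]

theorem spin_flipSet (S : Finset (Fin n)) (z : Fin n → Fin 2) (u : Fin n) :
    spin (flipSet S z u) = (if u ∈ S then -1 else 1) * spin (z u) := by
  by_cases h : u ∈ S <;> simp [flipSet, h, spin_add_one]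

/-! ### Pauli and coupling operators in the computational basis -/

/-- The eigenvalue of `couplingOp c` on the basis state `z`. -/
def energy (c : Sym2 (Fin n) → ℝ) (z : Fin n → Fin 2) : ℝ :=
  ∑ u, ∑ v ∈ Finset.Ioi u, c s(u, v) * (spin (z u) * spin (z v))

theorem sigmaZ_eq_diagonal (u : Fin n) :
    sigmaZ u = Matrix.diagonal fun z => (spin (z u) : ℂ) := by
  ext z w
  by_cases hzw : z = w
  · subst hzw
    simp only [sigmaZ, onQubit, Matrix.of_apply, implies_true, if_true, Matrix.diagonal_apply_eq]
    generalize z u = a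
    fin_cases a <;> simp
  · rw [Matrix.diagonal_apply_ne _ hzw]
    simp only [sigmaZ, onQubit, Matrix.of_apply, ite_eq_right_iff]
    intro h
    have hu : z u ≠ w u := fun hu => hzw (funext fun v => by
      by_cases hv : v = u
      · exact hv ▸ hu
      · exact h v hv)
    generalize z u = a at hu
    generalize w u = b at hu
    fin_cases a <;> fin_cases b <;> simp_all

theorem sigmaZ_mul_sigmaZ (u v : Fin n) :
    sigmaZ u * sigmaZ v =
      Matrix.diagonal fun z => ((spin (z u) * spin (z v) : ℝ) : ℂ) := by
  simp [sigmaZ_eq_diagonal]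

theorem sigmaX_mul_apply (u : Fin n) (A : Operator n) (z w : Fin n → Fin 2) :
    (sigmaX u * A) z w = A (flipSet {u} z) w := by
  rw [Matrix.mul_apply, Finset.sum_eq_single (flipSet {u} z)]
  · have h : sigmaX u z (flipSet {u} z) = 1 := by
      have hv : ∀ v, v ≠ u → z v = flipSet {u} z v := fun v hv => by simp [flipSet, hv]
      simp only [sigmaX, onQubit, Matrix.of_apply, if_pos hv]
      simp only [flipSet, Finset.mem_singleton, if_true]
      generalize z u = a
      fin_cases a <;> simp
    rw [h, one_mul]
  · intro y _ hy
    convert zero_mul _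
    simp only [sigmaX, onQubit, Matrix.of_apply, ite_eq_right_iff]
    intro h
    have hu : y u ≠ z u + 1 := fun hu => hy (funext fun v => by
      by_cases hv : v = u
      · subst hv; simp [flipSet, hu]
      · simp [flipSet, hv, h v hv])
    generalize z u = a at hu
    generalize y u = b at hu
    fin_cases a <;> fin_cases b <;> simp_all
  · simp

theorem sigmaX_conjTranspose (u : Fin n) : (sigmaX u : Operator n)ᴴ = sigmaX u := by
  ext z w
  simp only [sigmaX, onQubit, Matrix.conjTranspose_apply, Matrix.of_apply]
  have h : (∀ v, v ≠ u → w v = z v) ↔ ∀ v, v ≠ u → z v = w v :=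
    forall₂_congr fun _ _ => eq_comm
  simp only [h]
  split_ifs
  · generalize z u = a
    generalize w u = b
    fin_cases a <;> fin_cases b <;> simp
  · simp

theorem mul_sigmaX_apply (u : Fin n) (A : Operator n) (z w : Fin n → Fin 2) :
    (A * sigmaX u) z w = A z (flipSet {u} w) := by
  have h := sigmaX_mul_apply u Aᴴ w z
  rw [← sigmaX_conjTranspose, ← Matrix.conjTranspose_mul, Matrix.conjTranspose_apply,
    Matrix.conjTranspose_apply] at h
  exact star_injective h

theorem couplingOp_eq_diagonal (c : Sym2 (Fin n) → ℝ) :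
    couplingOp c = Matrix.diagonal fun z => (energy c z : ℂ) := by
  ext z w
  by_cases h : z = w
  · subst h
    simp [couplingOp, energy, sigmaZ_mul_sigmaZ, Matrix.sum_apply]
  · simp [couplingOp, sigmaZ_mul_sigmaZ, Matrix.sum_apply, h]

theorem isingOp_eq_couplingOp : isingOp n = couplingOp fun _ => 1 := by
  simp [isingOp, couplingOp]

theorem nativeH_eq_diagonal :
    nativeH n = Matrix.diagonal fun z => (n : ℂ)⁻¹ * (energy (fun _ => 1) z : ℂ) := by
  rw [nativeH, isingOp_eq_couplingOp, couplingOp_eq_diagonal, ← Matrix.diagonal_smul]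
  rfl

theorem flippedIsingOp_eq_diagonal (S : Finset (Fin n)) :
    flippedIsingOp S =
      Matrix.diagonal fun z => (energy (fun _ => 1) (flipSet S z) : ℂ) := by
  ext z w
  by_cases h : z = w
  · subst h
    simp only [flippedIsingOp, energy, sigmaZ_mul_sigmaZ, Matrix.sum_apply, Matrix.smul_apply,
      Matrix.diagonal_apply_eq, smul_eq_mul, Complex.ofReal_sum, spin_flipSet]
    refine Finset.sum_congr rfl fun u _ => Finset.sum_congr rfl fun v _ => ?_
    split_ifs <;> simp
  · simp [flippedIsingOp, sigmaZ_mul_sigmaZ, Matrix.sum_apply, h]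

/-! ### Solving the master equation entry by entry -/

/-- The rate at which dephasing with rate `Γ` damps the matrix entry `(z, w)`. -/
def dampingRate (Γ : ℝ) (z w : Fin n → Fin 2) : ℝ :=
  Γ / 4 * ∑ u, (1 - spin (z u) * spin (w u))

theorem dampingRate_flipSet_flipSet (Γ : ℝ) (S : Finset (Fin n)) (z w : Fin n → Fin 2) :
    dampingRate Γ (flipSet S z) (flipSet S w) = dampingRate Γ z w := by
  simp only [dampingRate, spin_flipSet]
  congr 1
  refine Finset.sum_congr rfl fun u _ => ?_
  split_ifs <;> ring

/-- With `a`, `b` the spins of `z`, `w` at `u`, the jump at `u` contributes `Γ/8 (a² - 2ab + b²) =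
Γ/4 (1 - ab)`. -/
theorem lindbladian_diagonal_apply {Γ : ℝ} (hΓ : 0 ≤ Γ) (h : (Fin n → Fin 2) → ℂ)
    (ρ : Operator n) (z w : Fin n → Fin 2) :
    lindbladian Γ (Matrix.diagonal h) ρ z w =
      (-Complex.I * (h z - h w) - dampingRate Γ z w) * ρ z w := by
  have hs : (Real.sqrt (Γ / 8) : ℂ) * (Real.sqrt (Γ / 8) : ℂ) = Γ / 8 := by
    rw [← Complex.ofReal_mul, Real.mul_self_sqrt (by positivity)]
    push_cast; rfl
  have hj (u : Fin n) : jump Γ u =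
      Matrix.diagonal fun z => (Real.sqrt (Γ / 8) : ℂ) * (spin (z u) : ℂ) := by
    rw [jump, sigmaZ_eq_diagonal, ← Matrix.diagonal_smul]; rfl
  have hjH (u : Fin n) : (jump Γ u)ᴴ = jump Γ u := by
    rw [hj, Matrix.diagonal_conjTranspose]
    congr 1
    funext z
    simp
  have hsq (b : Fin 2) : (spin b : ℂ) * (spin b : ℂ) = 1 := by
    rw [← Complex.ofReal_mul, spin_mul_self, Complex.ofReal_one]
  have hterm (u : Fin n) :
      (jump Γ u * (jump Γ u)ᴴ * ρ - (2 : ℂ) • (jump Γ u * ρ * (jump Γ u)ᴴ)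
        + ρ * (jump Γ u * (jump Γ u)ᴴ)) z w =
      Γ / 4 * (1 - (spin (z u) : ℂ) * spin (w u)) * ρ z w := by
    rw [hjH, hj]
    simp only [Matrix.add_apply, Matrix.sub_apply, Matrix.smul_apply, Matrix.diagonal_mul_diagonal,
      Matrix.diagonal_mul, Matrix.mul_diagonal, smul_eq_mul]
    linear_combination (ρ z w) * ((spin (z u) : ℂ) * spin (z u) - 2 * spin (z u) * spin (w u)
      + (spin (w u) : ℂ) * spin (w u)) * hs + ρ z w * Γ / 8 * hsq (z u)
      + ρ z w * Γ / 8 * hsq (w u)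
  simp only [lindbladian, Matrix.sub_apply, Matrix.neg_apply, Matrix.smul_apply, Matrix.sum_apply,
    hterm, Matrix.diagonal_mul, Matrix.mul_diagonal, smul_eq_mul, ← Finset.sum_mul,
    ← Finset.mul_sum, dampingRate]
  push_cast
  ring

/-- The integrating factor `exp (-a x)` makes the product constant. This is the uniqueness half of
solving a pulse. -/
theorem eq_exp_mul_of_hasDerivWithinAt {f : ℝ → ℂ} {a : ℂ} {T : ℝ} (hT : 0 ≤ T)
    (h : ∀ s ∈ Set.Icc 0 T, HasDerivWithinAt f (a * f s) (Set.Icc 0 T) s) :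
    f T = Complex.exp (a * T) * f 0 := by
  have he (s : ℝ) : HasDerivAt (fun x : ℝ => Complex.exp (-a * x))
      (Complex.exp (-a * s) * -a) s := by
    have := ((Complex.ofRealCLM.hasDerivAt (x := s)).const_mul (-a)).cexp
    simpa using this
  have hg : ∀ s ∈ Set.Icc 0 T,
      HasDerivWithinAt (fun x : ℝ => Complex.exp (-a * x) * f x) 0 (Set.Icc 0 T) s := by
    intro s hs
    exact ((he s).hasDerivWithinAt.mul (h s hs)).congr_deriv (by ring)
  have key := constant_of_derivWithin_zero
    (fun s hs => (hg s hs).differentiableWithinAt)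
    (fun s hs => by
      have hs' := Set.Ico_subset_Icc_self hs
      exact (hg s hs').derivWithin
        (uniqueDiffOn_Icc (lt_of_le_of_lt hs.1 hs.2) s hs')) T ⟨hT, le_rfl⟩
  simp only [Complex.ofReal_zero, mul_zero, Complex.exp_zero, one_mul] at key
  rw [← key, ← mul_assoc, ← Complex.exp_add]
  simp

theorem hasDerivWithinAt_exp_mul (a b : ℂ) (s : ℝ) (t : Set ℝ) :
    HasDerivWithinAt (fun x : ℝ => Complex.exp (a * x) * b) (a * (Complex.exp (a * s) * b)) t s := by
  have := (((Complex.ofRealCLM.hasDerivAt (x := s)).const_mul a).cexp.mul_const b).hasDerivWithinAt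
    (s := t)
  refine this.congr_deriv ?_
  simp only [Complex.ofRealCLM_apply, Complex.ofReal_one]
  ring

theorem executes_pulse_iff {Γ : ℝ} (hΓ : 0 ≤ Γ) (s : ℤˣ) (τ : ℝ≥0) (P : Program n)
    (ρ ρ' : Operator n) :
    Executes Γ (Op.pulse s τ :: P) ρ ρ' ↔
      Executes Γ P (Matrix.of fun z w => Complex.exp
        ((-Complex.I * (((s : ℤ) : ℂ) * (n : ℂ)⁻¹ *
            (energy (fun _ => 1) z - energy (fun _ => 1) w)) - dampingRate Γ z w) * (τ : ℝ))
          * ρ z w) ρ' := by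
  have hH : ((s : ℤ) : ℂ) • nativeH n = Matrix.diagonal fun z =>
      ((s : ℤ) : ℂ) * ((n : ℂ)⁻¹ * (energy (fun _ => 1) z : ℂ)) := by
    rw [nativeH_eq_diagonal, ← Matrix.diagonal_smul]; rfl
  have hL (σ : Operator n) (z w : Fin n → Fin 2) :
      lindbladian Γ (((s : ℤ) : ℂ) • nativeH n) σ z w =
        (-Complex.I * (((s : ℤ) : ℂ) * (n : ℂ)⁻¹ *
            (energy (fun _ => 1) z - energy (fun _ => 1) w)) - dampingRate Γ z w) * σ z w := by
    rw [hH, lindbladian_diagonal_apply hΓ]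
    ring
  simp only [Executes, SolvesMasterEquation, hL]
  constructor
  · rintro ⟨r, hr, rfl, hE⟩
    convert hE using 1
    ext z w
    exact (eq_exp_mul_of_hasDerivWithinAt τ.2 fun s hs => hr s hs z w).symm
  · intro hE
    exact ⟨fun x => Matrix.of fun z w => Complex.exp
        ((-Complex.I * (((s : ℤ) : ℂ) * (n : ℂ)⁻¹ *
            (energy (fun _ => 1) z - energy (fun _ => 1) w)) - dampingRate Γ z w) * x)
          * ρ z w, fun x _ z w => hasDerivWithinAt_exp_mul _ _ _ _, by ext; simp, hE⟩

/-! ### Executing a whole program -/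

/-- Reading the state in the frame where the pending flips are undone makes a flip act trivially and
turns a pulse into evolution under the sign-changed Ising operator. Damping is invariant under
flipping both indices, so only the total duration enters it. The flip set `S` is general because the
induction changes it. -/
theorem executes_scale_iff {Γ : ℝ} (hΓ : 0 ≤ Γ) (γ : ℝ≥0) (P : Program n) :
    ∀ (S : Finset (Fin n)) (ρ ρ' : Operator n), Executes Γ (scale γ P) ρ ρ' ↔
      ∀ z w, ρ' (flipSet (netFlips S P) z) (flipSet (netFlips S P) w) =
        Complex.exp (-Complex.I * (γ : ℝ) * (accumulated S P z z - accumulated S P w w)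
          - dampingRate Γ z w * ((γ : ℝ) * (totalTime P : ℝ))) *
          ρ (flipSet S z) (flipSet S w) := by
  induction P with
  | nil =>
    intro S ρ ρ'
    simp only [scale, Executes, netFlips, accumulated, totalTime, Matrix.zero_apply]
    constructor
    · rintro rfl z w
      simp
    · intro h
      ext z w
      simpa [flipSet_involutive S _] using h (flipSet S z) (flipSet S w)
  | cons o P ih =>
    intro S ρ ρ'
    cases o with
    | flip u =>
      simp only [scale, Executes, netFlips, accumulated, totalTime]
      rw [ih (symmDiff S {u})]
      simp only [sigmaX_conjTranspose, mul_sigmaX_apply, sigmaX_mul_apply, flipSet_flipSet]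
      simp only [symmDiff_comm S {u}, symmDiff_symmDiff_cancel_left]
    | pulse s τ =>
      simp only [scale, netFlips, accumulated, totalTime]
      rw [executes_pulse_iff hΓ, ih S]
      refine forall₂_congr fun z w => ?_
      rw [Matrix.of_apply, ← mul_assoc, ← Complex.exp_add]
      simp only [dampingRate_flipSet_flipSet, flippedIsingOp_eq_diagonal, Matrix.add_apply,
        Matrix.smul_apply, Matrix.diagonal_apply_eq, smul_eq_mul]
      apply Eq.congr_right
      congr 2
      push_cast
      ring

theorem executes_scale_iff_of_compiles {Γ : ℝ} (hΓ : 0 ≤ Γ) (γ : ℝ≥0) {P : Program n}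
    {c : Sym2 (Fin n) → ℝ} (hP : Compiles P c) (ρ ρ' : Operator n) :
    Executes Γ (scale γ P) ρ ρ' ↔
      ρ' = Matrix.of fun z w => Complex.exp (-Complex.I * (γ : ℝ) * (energy c z - energy c w)
          - dampingRate Γ z w * ((γ : ℝ) * (totalTime P : ℝ))) * ρ z w := by
  rw [executes_scale_iff hΓ γ P ∅, hP.1, hP.2, couplingOp_eq_diagonal]
  simp [← Matrix.ext_iff]

/-! ### Conjugation by the mixer -/

theorem exp_smul_of_mul_self_eq_one {m : Type*} [Fintype m] [DecidableEq m] (a : ℂ)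
    {X : Matrix m m ℂ} (hX : X * X = 1) :
    NormedSpace.exp (a • X) = Complex.cosh a • (1 : Matrix m m ℂ) + Complex.sinh a • X := by
  -- Spectral decomposition: `(1 ± X) / 2` are the projections onto the eigenvalues `±1` of `X`.
  have hpow (k : ℕ) : (a • X) ^ k =
      a ^ k • ((1 / 2 : ℂ) • (1 + X)) + (-a) ^ k • ((1 / 2 : ℂ) • (1 - X)) := by
    induction k with
    | zero => simp only [pow_zero]; module
    | succ k ih =>
      rw [pow_succ, ih]
      simp only [add_mul, sub_mul, smul_mul_assoc, mul_smul_comm, one_mul, hX, pow_succ]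
      module
  have hs (b : ℂ) (A : Matrix m m ℂ) :
      HasSum (fun k : ℕ => ((k.factorial : ℂ)⁻¹ * b ^ k) • A) (Complex.exp b • A) := by
    have := NormedSpace.exp_series_hasSum_exp' (𝕂 := ℂ) b
    rw [← Complex.exp_eq_exp_ℂ] at this
    exact this.smul_const A
  rw [NormedSpace.exp_eq_tsum ℂ]
  have hsum := (hs a ((1 / 2 : ℂ) • (1 + X))).add (hs (-a) ((1 / 2 : ℂ) • (1 - X)))
  simp only [mul_smul, ← smul_add, ← hpow] at hsum
  refine hsum.tsum_eq.trans ?_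
  rw [Complex.cosh, Complex.sinh]
  module

theorem sigmaX_apply (u : Fin n) (z w : Fin n → Fin 2) :
    sigmaX u z w = if flipSet {u} z = w then 1 else 0 := by
  rw [← mul_one (sigmaX u), sigmaX_mul_apply, Matrix.one_apply]

theorem sigmaX_mul_self (u : Fin n) : (sigmaX u : Operator n) * sigmaX u = 1 := by
  ext z w
  rw [sigmaX_mul_apply, sigmaX_apply, flipSet_involutive, Matrix.one_apply]

theorem sigmaX_commute (u v : Fin n) : Commute (sigmaX u : Operator n) (sigmaX v) := by
  ext z w
  simp only [sigmaX_mul_apply, sigmaX_apply, flipSet_flipSet, symmDiff_comm]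

theorem sigmaZ_mul_self (u : Fin n) : (sigmaZ u : Operator n) * sigmaZ u = 1 := by
  simp [sigmaZ_mul_sigmaZ, spin_mul_self]

theorem sigmaZ_mul_sigmaX_mul_sigmaZ (u v : Fin n) :
    (sigmaZ u * sigmaX v * sigmaZ u : Operator n) =
      if u = v then -sigmaX v else sigmaX v := by
  ext z w
  have hz := spin_mul_self (z u)
  rw [sigmaZ_eq_diagonal, Matrix.mul_diagonal, Matrix.diagonal_mul]
  have hif : (if u = v then -sigmaX v else sigmaX v : Operator n) z w =
      if u = v then -sigmaX v z w else sigmaX v z w := by split_ifs <;> rfl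
  rw [hif, sigmaX_apply]
  by_cases hw : flipSet {v} z = w
  · subst hw
    rw [if_pos rfl, mul_one, spin_flipSet, ← Complex.ofReal_mul, mul_left_comm, hz]
    by_cases h : u = v <;> simp [h]
  · simp [hw]

theorem sigmaZ_mul_sigmaX_of_ne {u v : Fin n} (h : u ≠ v) :
    (sigmaZ u * sigmaX v : Operator n) = sigmaX v * sigmaZ u := by
  have := congrArg (· * sigmaZ u) (sigmaZ_mul_sigmaX_mul_sigmaZ u v)
  simpa only [if_neg h, mul_assoc, sigmaZ_mul_self, mul_one] using this

theorem mixer_conjTranspose_mul_self (β : ℝ) : (mixer n β)ᴴ * mixer n β = 1 := by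
  rw [mixer, ← Matrix.exp_conjTranspose]
  have h : ((-(Complex.I * (β : ℂ))) • ∑ u : Fin n, (sigmaX u : Operator n))ᴴ =
      -((-(Complex.I * (β : ℂ))) • ∑ u : Fin n, (sigmaX u : Operator n)) := by
    simp [Matrix.conjTranspose_smul, Matrix.conjTranspose_sum, sigmaX_conjTranspose]
  generalize ((-(Complex.I * (β : ℂ))) • ∑ u : Fin n, (sigmaX u : Operator n)) = A at h
  have hA : Commute (-A) A := Commute.neg_left (Commute.refl A)
  rw [h, ← Matrix.exp_add_of_commute _ _ hA, neg_add_cancel,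
    NormedSpace.exp_zero]

theorem mixer_mul_conjTranspose_self (β : ℝ) : mixer n β * (mixer n β)ᴴ = 1 :=
  mul_eq_one_comm.mp (mixer_conjTranspose_mul_self β)

/-- Conjugation by `Z_u` reverses only the `X_u` term of the exponent. All `X_v` commute, so `Z_u U
Z_u = U exp(2iβ X_u)` for the mixer `U`; multiplying by `Uᴴ` on the left and `Z_u` on the right
gives the claim. -/
theorem mixer_conj_sigmaZ (β : ℝ) (u : Fin n) :
    (mixer n β)ᴴ * sigmaZ u * mixer n β =
      (((Real.cos (2 * β) : ℝ) : ℂ) • (1 : Operator n)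
        + (Complex.I * (Real.sin (2 * β) : ℝ)) • sigmaX u) * sigmaZ u := by
  set A : Operator n := (-(Complex.I * (β : ℂ))) • ∑ u : Fin n, (sigmaX u : Operator n) with hA
  have hinv : (sigmaZ u : Operator n)⁻¹ = sigmaZ u :=
    Matrix.inv_eq_right_inv (sigmaZ_mul_self u)
  have hconj : sigmaZ u * A * sigmaZ u = A + (2 * β * Complex.I) • sigmaX u := by
    have hsum : sigmaZ u * (∑ v : Fin n, (sigmaX v : Operator n)) * sigmaZ u =
        (∑ v : Fin n, (sigmaX v : Operator n)) - (2 : ℂ) • sigmaX u := by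
      have hv (v : Fin n) : (if u = v then -sigmaX v else sigmaX v : Operator n) =
          sigmaX v - if u = v then (2 : ℂ) • sigmaX v else 0 := by
        split_ifs
        · module
        · simp
      simp only [Finset.mul_sum, Finset.sum_mul, sigmaZ_mul_sigmaX_mul_sigmaZ, hv,
        Finset.sum_sub_distrib, Finset.sum_ite_eq, Finset.mem_univ, if_true]
    rw [hA, mul_smul_comm, smul_mul_assoc, hsum]
    module
  have hcomm : Commute A ((2 * β * Complex.I) • sigmaX u) :=
    ((Commute.sum_left _ _ _ fun v _ => sigmaX_commute v u).smul_left _).smul_right _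
  have hexp := Matrix.exp_conj (sigmaZ u) A
    (IsUnit.of_mul_eq_one _ (sigmaZ_mul_self u))
  rw [hinv, hconj, Matrix.exp_add_of_commute _ _ hcomm,
    exp_smul_of_mul_self_eq_one _ (sigmaX_mul_self u), Complex.cosh_mul_I, Complex.sinh_mul_I] at hexp
  change mixer n β * _ = sigmaZ u * mixer n β * sigmaZ u at hexp
  have h2 : sigmaZ u * mixer n β = sigmaZ u * mixer n β * sigmaZ u * sigmaZ u := by
    rw [mul_assoc _ (sigmaZ u) (sigmaZ u), sigmaZ_mul_self, mul_one]
  rw [mul_assoc, h2, ← hexp, mul_assoc, ← mul_assoc, mixer_conjTranspose_mul_self, one_mul]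
  push_cast
  rw [mul_comm Complex.I]

theorem trace_sigmaX_mul (u : Fin n) (A : Operator n) :
    (sigmaX u * A).trace = ∑ z, A z (flipSet {u} z) := by
  rw [Matrix.trace_mul_comm]
  simp [Matrix.trace, mul_sigmaX_apply]

theorem trace_sigmaX_mul_sigmaX_mul {u v : Fin n} (h : u ≠ v) (A : Operator n) :
    (sigmaX u * (sigmaX v * A)).trace = ∑ z, A z (flipSet {u, v} z) := by
  have hs : symmDiff ({u} : Finset (Fin n)) {v} = {u, v} := by
    rw [(Finset.disjoint_singleton.mpr h).symmDiff_eq_sup]; rfl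
  rw [← mul_assoc, Matrix.trace_mul_comm, ← mul_assoc]
  simp [Matrix.trace, mul_sigmaX_apply, flipSet_flipSet, hs]

/-- After cycling the mixer onto `Z_u Z_v`, each string of `X` operators in the expansion picks out,
under the trace, the entries whose indices differ by exactly those flips. -/
theorem trace_sigmaZ_mul_sigmaZ_mul_mixer_conj {u v : Fin n} (huv : u ≠ v) (β : ℝ)
    (σ : Operator n) :
    (sigmaZ u * sigmaZ v * (mixer n β * σ * (mixer n β)ᴴ)).trace =
      (Real.cos (2 * β) : ℂ) ^ 2 * ∑ z, (spin (z u) * spin (z v) : ℝ) * σ z z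
      + Complex.I * (Real.sin (2 * β) : ℂ) * (Real.cos (2 * β) : ℂ) *
        (∑ z, (spin (z u) * spin (z v) : ℝ) * σ z (flipSet {u} z)
          + ∑ z, (spin (z u) * spin (z v) : ℝ) * σ z (flipSet {v} z))
      - (Real.sin (2 * β) : ℂ) ^ 2 *
        ∑ z, (spin (z u) * spin (z v) : ℝ) * σ z (flipSet {u, v} z) := by
  have hU : (mixer n β)ᴴ * (sigmaZ u * sigmaZ v) * mixer n β =
      ((mixer n β)ᴴ * sigmaZ u * mixer n β) * ((mixer n β)ᴴ * sigmaZ v * mixer n β) := by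
    have : (mixer n β)ᴴ * (sigmaZ u * sigmaZ v) * mixer n β =
      (mixer n β)ᴴ * sigmaZ u * (mixer n β * (mixer n β)ᴴ) * sigmaZ v * mixer n β := by
        rw [mixer_mul_conjTranspose_self]; noncomm_ring
    rw [this]; noncomm_ring
  have hexpand : (mixer n β)ᴴ * (sigmaZ u * sigmaZ v) * mixer n β * σ =
      (Real.cos (2 * β) : ℂ) ^ 2 • (sigmaZ u * sigmaZ v * σ)
      + (Complex.I * (Real.sin (2 * β) : ℂ) * (Real.cos (2 * β) : ℂ)) •
        (sigmaX u * (sigmaZ u * sigmaZ v * σ) + sigmaX v * (sigmaZ u * sigmaZ v * σ))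
      - ((Real.sin (2 * β) : ℂ) ^ 2) •
        (sigmaX u * (sigmaX v * (sigmaZ u * sigmaZ v * σ))) := by
    have hc : (sigmaZ u : Operator n) * (sigmaX v * (sigmaZ v * σ)) =
        sigmaX v * (sigmaZ u * (sigmaZ v * σ)) := by
      rw [← mul_assoc, sigmaZ_mul_sigmaX_of_ne huv, mul_assoc]
    rw [hU, mixer_conj_sigmaZ, mixer_conj_sigmaZ]
    generalize (Real.cos (2 * β) : ℂ) = k
    generalize (Real.sin (2 * β) : ℂ) = s
    simp only [add_mul, mul_add, smul_mul_assoc, mul_smul_comm, one_mul, mul_assoc, hc,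
      smul_add, smul_smul]
    match_scalars <;> first | ring1 | linear_combination s ^ 2 * Complex.I_sq
  have hcycle : (sigmaZ u * sigmaZ v * (mixer n β * σ * (mixer n β)ᴴ)).trace =
      ((mixer n β)ᴴ * (sigmaZ u * sigmaZ v) * mixer n β * σ).trace := by
    rw [← mul_assoc, Matrix.trace_mul_comm]
    simp only [mul_assoc]
  rw [hcycle, hexpand]
  simp only [Matrix.trace_sub, Matrix.trace_add, Matrix.trace_smul, trace_sigmaX_mul,
    trace_sigmaX_mul_sigmaX_mul huv, sigmaZ_mul_sigmaZ, Matrix.diagonal_mul, smul_eq_mul]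
  simp [Matrix.trace, Matrix.diagonal_mul]

/-! ### Evaluating the sums over basis states -/

theorem energy_sub_energy_flipSet (c : Sym2 (Fin n) → ℝ) (S : Finset (Fin n))
    (z : Fin n → Fin 2) :
    energy c z - energy c (flipSet S z) =
      2 * ∑ x ∈ S, ∑ y ∈ Sᶜ, c s(x, y) * (spin (z x) * spin (z y)) := by
  -- Only pairs with exactly one end in `S` change sign. The condition orients each such pair from
  -- `S` to its complement, so the sum over ordered pairs counts it once.
  have h := Finset.sum_sum_Ioi_add_eq_sum_sum_off_diag (fun j i : Fin n =>
    if i ∈ S ∧ j ∉ S then c s(i, j) * (spin (z i) * spin (z j)) else 0)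
  have hR : ∑ x ∈ S, ∑ y ∈ Sᶜ, c s(x, y) * (spin (z x) * spin (z y)) =
      ∑ i, ∑ j ∈ ({i} : Finset (Fin n))ᶜ,
        if i ∈ S ∧ j ∉ S then c s(i, j) * (spin (z i) * spin (z j)) else 0 := by
    rw [← Finset.sum_subset (Finset.subset_univ S)
      (fun i _ hi => Finset.sum_eq_zero fun j _ => by simp [hi])]
    refine Finset.sum_congr rfl fun i hi => ?_
    refine (Finset.sum_congr rfl fun j hj => ?_).trans
      (Finset.sum_subset (s₁ := Sᶜ) (fun j hj => ?_) fun j _ hj => ?_)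
    · simp [hi, Finset.mem_compl.mp hj]
    · rw [Finset.mem_compl, Finset.mem_singleton]
      rintro rfl
      exact Finset.mem_compl.mp hj hi
    · rw [Finset.mem_compl, not_not] at hj
      simp [hj]
  rw [hR, ← h, energy, energy, ← Finset.sum_sub_distrib, Finset.mul_sum]
  refine Finset.sum_congr rfl fun u _ => ?_
  rw [← Finset.sum_sub_distrib, Finset.mul_sum]
  refine Finset.sum_congr rfl fun v _ => ?_
  rw [spin_flipSet, spin_flipSet, Sym2.eq_swap (a := v)]
  by_cases hu : u ∈ S <;> by_cases hv : v ∈ S <;> simp [hu, hv] <;> ring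

/-- Source of the two damping factors: one flip gives the rate `Γ / 2`, two flips give `Γ`. -/
theorem dampingRate_flipSet (Γ : ℝ) (S : Finset (Fin n)) (z : Fin n → Fin 2) :
    dampingRate Γ z (flipSet S z) = Γ / 2 * S.card := by
  have h (u : Fin n) : 1 - spin (z u) * spin (flipSet S z u) = if u ∈ S then 2 else 0 := by
    rw [spin_flipSet, mul_left_comm, spin_mul_self]
    split_ifs <;> norm_num
  simp only [dampingRate, h, Finset.sum_ite_mem, Finset.univ_inter, Finset.sum_const, nsmul_eq_mul]
  ring

theorem prod_univ_eq_mul_prod_compl_pair {M : Type*} [CommMonoid M] {u v : Fin n} (h : u ≠ v)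
    (f : Fin n → M) : ∏ μ, f μ = f u * f v * ∏ μ ∈ ({u, v} : Finset (Fin n))ᶜ, f μ := by
  rw [← Finset.prod_mul_prod_compl {u, v}, Finset.prod_pair h]

/-- A sum over basis states whose summand factorises over the qubits once the bits of `u` and `v`
are fixed. -/
theorem sum_mul_prod_compl_pair {u v : Fin n} (h : u ≠ v) (φ : Fin 2 → Fin 2 → ℂ)
    (g : Fin n → Fin 2 → Fin 2 → Fin 2 → ℂ) :
    ∑ z : Fin n → Fin 2, φ (z u) (z v) *
        ∏ μ ∈ ({u, v} : Finset (Fin n))ᶜ, g μ (z u) (z v) (z μ) =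
      ∑ a, ∑ b, φ a b * ∏ μ ∈ ({u, v} : Finset (Fin n))ᶜ, ∑ x, g μ a b x := by
  have hfix (a b : Fin 2) : ∏ μ ∈ ({u, v} : Finset (Fin n))ᶜ, ∑ x, g μ a b x =
      ∑ z : Fin n → Fin 2, (if z u = a then 1 else 0) * (if z v = b then 1 else 0) *
        ∏ μ ∈ ({u, v} : Finset (Fin n))ᶜ, g μ a b (z μ) := by
    -- Placing indicators of the prescribed bits at `u` and `v` makes the constrained sum a full
    -- product over all qubits, so `Finset.prod_univ_sum` applies.
    let f : Fin n → Fin 2 → ℂ := fun μ x =>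
      if μ = u then (if x = a then 1 else 0) else if μ = v then (if x = b then 1 else 0)
      else g μ a b x
    have hf : ∀ μ ∈ ({u, v} : Finset (Fin n))ᶜ, ∀ x, f μ x = g μ a b x := by
      intro μ hμ x
      simp only [Finset.mem_compl, Finset.mem_insert, Finset.mem_singleton, not_or] at hμ
      simp [f, hμ.1, hμ.2]
    have hprod := Finset.prod_univ_sum (fun _ : Fin n => (Finset.univ : Finset (Fin 2))) f
    rw [Fintype.piFinset_univ, prod_univ_eq_mul_prod_compl_pair h] at hprod
    have hu : ∑ x, f u x = 1 := by simp [f]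
    have hv : ∑ x, f v x = 1 := by simp [f, h.symm]
    rw [hu, hv, one_mul, one_mul] at hprod
    rw [Finset.prod_congr rfl fun μ hμ => Finset.sum_congr rfl fun x _ => (hf μ hμ x).symm, hprod]
    refine Finset.sum_congr rfl fun z _ => ?_
    rw [prod_univ_eq_mul_prod_compl_pair h,
      Finset.prod_congr rfl fun μ hμ => hf μ hμ (z μ)]
    simp [f, h.symm]
  simp only [hfix, Finset.mul_sum]
  simp_rw [Finset.sum_comm (s := (Finset.univ : Finset (Fin 2)))
    (t := (Finset.univ : Finset (Fin n → Fin 2)))]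
  refine Finset.sum_congr rfl fun z _ => ?_
  rw [Finset.sum_eq_single (z u), Finset.sum_eq_single (z v)]
  · simp
  · intro b _ hb; simp [hb.symm]
  · simp
  · intro a _ ha; simp [ha.symm]
  · simp

theorem sum_half_mul_exp_spin (θ : ℝ) :
    ∑ x : Fin 2, (1 / 2 : ℂ) * Complex.exp (-Complex.I * (θ * spin x : ℝ)) = Real.cos θ := by
  rw [Fin.sum_univ_two, Complex.ofReal_cos, Complex.cos]
  simp only [spin_zero, spin_one]
  push_cast
  ring_nf

theorem cos_mul_spin (θ : ℝ) (a : Fin 2) : Real.cos (θ * spin a) = Real.cos θ := by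
  fin_cases a <;> simp

theorem prod_half_eq {u v : Fin n} (h : u ≠ v) :
    ∏ _i : Fin n, (1 / 2 : ℂ) = 1 / 4 * ∏ _μ ∈ ({u, v} : Finset (Fin n))ᶜ, (1 / 2 : ℂ) := by
  rw [prod_univ_eq_mul_prod_compl_pair h]
  norm_num

theorem sum_spin_mul_spin {u v : Fin n} (h : u ≠ v) :
    ∑ z : Fin n → Fin 2, ((spin (z u) * spin (z v) : ℝ) : ℂ) * ∏ _i : Fin n, (1 / 2 : ℂ) = 0 := by
  have := sum_mul_prod_compl_pair h
    (fun a b => ((spin a * spin b : ℝ) : ℂ) * (1 / 4)) fun _ _ _ _ => 1 / 2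
  simp only [prod_half_eq h, ← mul_assoc]
  rw [this]
  simp [Fin.sum_univ_two]

/-- The cosines of the other qubits do not see the sign of the spin at `u`. What remains, with `θ =
2γ c_uv`, is the sum of `ab exp(-iθab) / 4` over spins `a`, `b`, which is `-i sin θ`. -/
theorem sum_spin_mul_spin_mul_exp_single (c : Sym2 (Fin n) → ℝ) (γ : ℝ) {u v : Fin n}
    (h : u ≠ v) :
    ∑ z : Fin n → Fin 2, ((spin (z u) * spin (z v) : ℝ) : ℂ) *
        (Complex.exp (-Complex.I * γ * (energy c z - energy c (flipSet {u} z) : ℝ)) *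
          ∏ _i : Fin n, (1 / 2 : ℂ)) =
      -Complex.I * (Real.sin (2 * γ * c s(u, v)) *
        ∏ μ ∈ ({u, v} : Finset (Fin n))ᶜ, Real.cos (2 * γ * c s(μ, u)) : ℝ) := by
  have hcompl : ({u} : Finset (Fin n))ᶜ = insert v ({u, v} : Finset (Fin n))ᶜ := by
    ext x
    simp only [Finset.mem_compl, Finset.mem_singleton, Finset.mem_insert]
    by_cases hx : x = v
    · simp [hx, h.symm]
    · simp [hx]
  have hterm (z : Fin n → Fin 2) : ((spin (z u) * spin (z v) : ℝ) : ℂ) *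
        (Complex.exp (-Complex.I * γ * (energy c z - energy c (flipSet {u} z) : ℝ)) *
          ∏ _i : Fin n, (1 / 2 : ℂ)) =
      (1 / 4 * (spin (z u) * spin (z v) : ℝ) * Complex.exp (-Complex.I *
        (2 * γ * c s(u, v) * (spin (z u) * spin (z v)) : ℝ))) *
        ∏ μ ∈ ({u, v} : Finset (Fin n))ᶜ, ((1 / 2 : ℂ) *
          Complex.exp (-Complex.I * (2 * γ * c s(μ, u) * spin (z u) * spin (z μ) : ℝ))) := by
    rw [energy_sub_energy_flipSet, Finset.sum_singleton, hcompl, Finset.sum_insert (by simp),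
      Finset.prod_mul_distrib, ← Complex.exp_sum, prod_half_eq h]
    have hexp : Complex.exp (-Complex.I * γ * (2 * (c s(u, v) * (spin (z u) * spin (z v)) +
          ∑ y ∈ ({u, v} : Finset (Fin n))ᶜ, c s(u, y) * (spin (z u) * spin (z y))) : ℝ)) =
        Complex.exp (-Complex.I * (2 * γ * c s(u, v) * (spin (z u) * spin (z v)) : ℝ)) *
        Complex.exp (∑ μ ∈ ({u, v} : Finset (Fin n))ᶜ,
          -Complex.I * (2 * γ * c s(μ, u) * spin (z u) * spin (z μ) : ℝ)) := by
      rw [← Complex.exp_add, ← Finset.mul_sum, ← Complex.ofReal_sum]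
      have : ∑ μ ∈ ({u, v} : Finset (Fin n))ᶜ, 2 * γ * c s(μ, u) * spin (z u) * spin (z μ) =
          2 * γ * ∑ y ∈ ({u, v} : Finset (Fin n))ᶜ, c s(u, y) * (spin (z u) * spin (z y)) := by
        rw [Finset.mul_sum]
        refine Finset.sum_congr rfl fun y _ => ?_
        rw [Sym2.eq_swap]; ring
      rw [this]
      push_cast
      ring_nf
    rw [hexp]
    ring
  simp only [hterm]
  rw [sum_mul_prod_compl_pair h
    (fun a b => 1 / 4 * (spin a * spin b : ℝ) * Complex.exp (-Complex.I *
        (2 * γ * c s(u, v) * (spin a * spin b) : ℝ)))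
    (fun μ a _ x => (1 / 2 : ℂ) *
      Complex.exp (-Complex.I * (2 * γ * c s(μ, u) * spin a * spin x : ℝ)))]
  simp only [sum_half_mul_exp_spin, cos_mul_spin, ← Finset.sum_mul, ← Complex.ofReal_prod]
  rw [Complex.ofReal_mul, ← mul_assoc]
  congr 1
  simp only [Fin.sum_univ_two, spin_zero, spin_one]
  rw [Complex.ofReal_sin, Complex.sin]
  push_cast
  ring_nf
  simp only [Complex.I_sq]
  ring_nf

/-- The coupling between `u` and `v` drops out since both ends flip. Equal spins at `u` and `v` give
the cosines of sums with sign `+`, opposite spins those of differences with sign `-`. -/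
theorem sum_spin_mul_spin_mul_exp_pair (c : Sym2 (Fin n) → ℝ) (γ : ℝ) {u v : Fin n}
    (h : u ≠ v) :
    ∑ z : Fin n → Fin 2, ((spin (z u) * spin (z v) : ℝ) : ℂ) *
        (Complex.exp (-Complex.I * γ * (energy c z - energy c (flipSet {u, v} z) : ℝ)) *
          ∏ _i : Fin n, (1 / 2 : ℂ)) =
      (((∏ μ ∈ ({u, v} : Finset (Fin n))ᶜ, Real.cos (2 * γ * (c s(μ, u) + c s(μ, v))))
        - ∏ μ ∈ ({u, v} : Finset (Fin n))ᶜ, Real.cos (2 * γ * (c s(μ, u) - c s(μ, v)))) / 2 :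
        ℝ) := by
  have hterm (z : Fin n → Fin 2) : ((spin (z u) * spin (z v) : ℝ) : ℂ) *
        (Complex.exp (-Complex.I * γ * (energy c z - energy c (flipSet {u, v} z) : ℝ)) *
          ∏ _i : Fin n, (1 / 2 : ℂ)) =
      (1 / 4 * (spin (z u) * spin (z v) : ℝ)) *
        ∏ μ ∈ ({u, v} : Finset (Fin n))ᶜ, ((1 / 2 : ℂ) *
          Complex.exp (-Complex.I * (2 * γ * (c s(μ, u) * spin (z u) + c s(μ, v) * spin (z v))
            * spin (z μ) : ℝ))) := by
    rw [energy_sub_energy_flipSet, Finset.sum_pair h, ← Finset.sum_add_distrib,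
      Finset.prod_mul_distrib, ← Complex.exp_sum, prod_half_eq h]
    have hexp : -Complex.I * γ * (2 * ∑ y ∈ ({u, v} : Finset (Fin n))ᶜ,
          (c s(u, y) * (spin (z u) * spin (z y)) + c s(v, y) * (spin (z v) * spin (z y))) : ℝ) =
        ∑ μ ∈ ({u, v} : Finset (Fin n))ᶜ, -Complex.I *
          (2 * γ * (c s(μ, u) * spin (z u) + c s(μ, v) * spin (z v)) * spin (z μ) : ℝ) := by
      rw [Finset.mul_sum, Complex.ofReal_sum, Finset.mul_sum]
      refine Finset.sum_congr rfl fun y _ => ?_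
      rw [Sym2.eq_swap (a := u), Sym2.eq_swap (a := v)]
      push_cast
      ring
    rw [hexp]
    ring
  simp only [hterm]
  rw [sum_mul_prod_compl_pair h (fun a b => 1 / 4 * (spin a * spin b : ℝ))
    (fun μ a b x => (1 / 2 : ℂ) * Complex.exp (-Complex.I *
      (2 * γ * (c s(μ, u) * spin a + c s(μ, v) * spin b) * spin x : ℝ)))]
  simp only [sum_half_mul_exp_spin, ← Complex.ofReal_prod]
  have h₁ (μ : Fin n) : Real.cos (2 * γ * (c s(μ, u) * -1 + c s(μ, v))) =
      Real.cos (2 * γ * (c s(μ, u) - c s(μ, v))) := by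
    rw [← Real.cos_neg]; ring_nf
  have h₂ (μ : Fin n) : Real.cos (2 * γ * (c s(μ, u) * -1 + c s(μ, v) * -1)) =
      Real.cos (2 * γ * (c s(μ, u) + c s(μ, v))) := by
    rw [← Real.cos_neg]; ring_nf
  have h₃ (μ : Fin n) : Real.cos (2 * γ * (c s(μ, u) + c s(μ, v) * -1)) =
      Real.cos (2 * γ * (c s(μ, u) - c s(μ, v))) := by
    ring_nf
  simp only [Fin.sum_univ_two, spin_zero, spin_one, mul_one, h₁, h₂, h₃]
  generalize ∏ μ ∈ ({u, v} : Finset (Fin n))ᶜ, Real.cos (2 * γ * (c s(μ, u) + c s(μ, v))) = A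
  generalize ∏ μ ∈ ({u, v} : Finset (Fin n))ᶜ, Real.cos (2 * γ * (c s(μ, u) - c s(μ, v))) = B
  push_cast
  ring

/-! ### The output state and its two-point correlations -/

theorem plusState_apply (z w : Fin n → Fin 2) : plusState n z w = ∏ _i : Fin n, (1 / 2 : ℂ) := by
  simp only [plusState, Matrix.vecMulVec_apply, plusVec, Pi.star_apply, star_prod,
    ← Finset.prod_mul_distrib]
  refine Finset.prod_congr rfl fun _ _ => ?_
  have h : (Real.sqrt 2 : ℂ) * Real.sqrt 2 = 2 := by
    rw [← Complex.ofReal_mul, Real.mul_self_sqrt (by norm_num)]; norm_num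
  rw [star_inv₀, Complex.star_def, Complex.conj_ofReal, ← mul_inv, h, one_div]

/-- The state after the noisy execution, for time `t`, of a compilation of the coupling `c`
with angle `γ`. -/
def dephasedState (Γ γ t : ℝ) (c : Sym2 (Fin n) → ℝ) : Operator n :=
  Matrix.of fun z w => Complex.exp (-Complex.I * γ * (energy c z - energy c w : ℝ)) *
    Real.exp (-(dampingRate Γ z w * t)) * ∏ _i : Fin n, (1 / 2 : ℂ)

theorem executes_plusState_iff {Γ : ℝ} (hΓ : 0 ≤ Γ) (γ : ℝ≥0) {P : Program n}
    {c : Sym2 (Fin n) → ℝ} (hP : Compiles P c) (σ : Operator n) :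
    Executes Γ (scale γ P) (plusState n) σ ↔
      σ = dephasedState Γ γ ((γ : ℝ) * (totalTime P : ℝ)) c := by
  rw [executes_scale_iff_of_compiles hΓ γ hP]
  apply Eq.congr_right
  ext z w
  simp only [dephasedState, Matrix.of_apply, plusState_apply]
  rw [Complex.ofReal_exp, ← Complex.exp_add]
  push_cast
  ring_nf

theorem isQAOAOutput_iff {Γ : ℝ} (hΓ : 0 ≤ Γ) (γ : ℝ≥0) (β : ℝ) {P : Program n}
    {c : Sym2 (Fin n) → ℝ} (hP : Compiles P c) (ρ : Operator n) :
    IsQAOAOutput Γ P γ β ρ ↔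
      ρ = mixer n β * dephasedState Γ γ ((γ : ℝ) * (totalTime P : ℝ)) c * (mixer n β)ᴴ := by
  simp [IsQAOAOutput, executes_plusState_iff hΓ γ hP]

theorem sum_spin_mul_dephasedState_flipSet (Γ γ t : ℝ) (c : Sym2 (Fin n) → ℝ) (u v : Fin n)
    (S : Finset (Fin n)) :
    ∑ z, ((spin (z u) * spin (z v) : ℝ) : ℂ) * dephasedState Γ γ t c z (flipSet S z) =
      Real.exp (-(Γ / 2 * S.card * t)) * ∑ z : Fin n → Fin 2,
        ((spin (z u) * spin (z v) : ℝ) : ℂ) *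
        (Complex.exp (-Complex.I * γ * (energy c z - energy c (flipSet S z) : ℝ)) *
          ∏ _i : Fin n, (1 / 2 : ℂ)) := by
  rw [Finset.mul_sum]
  refine Finset.sum_congr rfl fun z _ => ?_
  rw [dephasedState, Matrix.of_apply, dampingRate_flipSet]
  ring

theorem expectation_sigmaZ_mul_sigmaZ_mixer_dephasedState (Γ γ t β : ℝ) (c : Sym2 (Fin n) → ℝ)
    {u v : Fin n} (h : u ≠ v) :
    expectation (sigmaZ u * sigmaZ v)
        (mixer n β * dephasedState Γ γ t c * (mixer n β)ᴴ) =
      ((Real.sin (4 * β) * Real.sin (2 * γ * c s(u, v)) * Real.exp (-Γ * t / 2) / 2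
          * ((∏ μ ∈ ({u, v} : Finset (Fin n))ᶜ, Real.cos (2 * γ * c s(μ, v)))
            + ∏ μ ∈ ({u, v} : Finset (Fin n))ᶜ, Real.cos (2 * γ * c s(μ, u)))
        - Real.sin (2 * β) ^ 2 * Real.exp (-Γ * t) / 2
          * ((∏ μ ∈ ({u, v} : Finset (Fin n))ᶜ, Real.cos (2 * γ * (c s(μ, u) + c s(μ, v))))
            - ∏ μ ∈ ({u, v} : Finset (Fin n))ᶜ,
                Real.cos (2 * γ * (c s(μ, u) - c s(μ, v)))) : ℝ) : ℂ) := by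
  have h₀ : ∑ z, ((spin (z u) * spin (z v) : ℝ) : ℂ) * dephasedState Γ γ t c z z = 0 := by
    have := sum_spin_mul_dephasedState_flipSet Γ γ t c u v ∅
    simp only [flipSet_empty, sub_self, Complex.ofReal_zero, mul_zero, Complex.exp_zero, one_mul,
      sum_spin_mul_spin h] at this
    exact this
  -- The single-flip sum is stated with the flipped qubit first, so the flip of `v` uses it with `u`
  -- and `v` exchanged.
  have hv := sum_spin_mul_dephasedState_flipSet Γ γ t c v u {v}
  rw [sum_spin_mul_spin_mul_exp_single c γ h.symm, Finset.pair_comm v u,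
    Sym2.eq_swap (a := v) (b := u)] at hv
  have hswap (z : Fin n → Fin 2) : spin (z v) * spin (z u) = spin (z u) * spin (z v) :=
    mul_comm _ _
  simp only [hswap] at hv
  have h₄ : Real.sin (4 * β) = 2 * Real.sin (2 * β) * Real.cos (2 * β) := by
    rw [← Real.sin_two_mul]; ring_nf
  have he₁ : -(Γ / 2 * ((1 : ℕ) : ℝ) * t) = -Γ * t / 2 := by push_cast; ring
  have he₂ : -(Γ / 2 * ((2 : ℕ) : ℝ) * t) = -Γ * t := by push_cast; ring
  rw [expectation, trace_sigmaZ_mul_sigmaZ_mul_mixer_conj h, h₀, hv,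
    sum_spin_mul_dephasedState_flipSet, sum_spin_mul_dephasedState_flipSet,
    sum_spin_mul_spin_mul_exp_single c γ h, sum_spin_mul_spin_mul_exp_pair c γ h,
    Finset.card_singleton, Finset.card_singleton, Finset.card_pair h, he₁, he₂, h₄]
  generalize ∏ μ ∈ ({u, v} : Finset (Fin n))ᶜ, Real.cos (2 * γ * c s(μ, u)) = p
  generalize ∏ μ ∈ ({u, v} : Finset (Fin n))ᶜ, Real.cos (2 * γ * c s(μ, v)) = q
  generalize ∏ μ ∈ ({u, v} : Finset (Fin n))ᶜ, Real.cos (2 * γ * (c s(μ, u) + c s(μ, v))) = A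
  generalize ∏ μ ∈ ({u, v} : Finset (Fin n))ᶜ, Real.cos (2 * γ * (c s(μ, u) - c s(μ, v))) = B
  generalize Real.sin (2 * γ * c s(u, v)) = y
  generalize Real.sin (2 * β) = s
  generalize Real.cos (2 * β) = k
  generalize Real.exp (-Γ * t / 2) = e
  generalize Real.exp (-Γ * t) = e'
  push_cast
  -- The factor `i` of the single-flip terms meets the `-i` of their sums, which makes the result
  -- real.
  linear_combination -(s * k * e * y * (p + q) : ℂ) * Complex.I_sq

end DephasedQAOA

open DephasedQAOA in
theorem mainTheorem4 (n : ℕ) (c c' : Sym2 (Fin n) → ℝ) (P : DephasedQAOA.Program n)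
    (hP : DephasedQAOA.Compiles P c') (Γ : ℝ) (hΓ : 0 ≤ Γ) (γ : NNReal) (β t : ℝ)
    (ht : t = (γ : ℝ) * (DephasedQAOA.totalTime P : ℝ)) :
    (∃! ρ, DephasedQAOA.IsQAOAOutput Γ P γ β ρ) ∧
    ∀ ρ, DephasedQAOA.IsQAOAOutput Γ P γ β ρ →
      DephasedQAOA.expectation (DephasedQAOA.couplingOp c) ρ =
        (((∑ u : Fin n, ∑ v ∈ Finset.Ioi u,
            c s(u, v) * Real.sin (4 * β) * Real.sin (2 * γ * c' s(u, v))
                * Real.exp (-Γ * t / 2) / 2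
              * ((∏ μ ∈ ({u, v} : Finset (Fin n))ᶜ, Real.cos (2 * γ * c' s(μ, v)))
                + ∏ μ ∈ ({u, v} : Finset (Fin n))ᶜ, Real.cos (2 * γ * c' s(μ, u))))
          - ∑ u : Fin n, ∑ v ∈ Finset.Ioi u,
            c s(u, v) * Real.sin (2 * β) ^ 2 * Real.exp (-Γ * t) / 2
              * ((∏ μ ∈ ({u, v} : Finset (Fin n))ᶜ,
                    Real.cos (2 * γ * (c' s(μ, u) + c' s(μ, v))))
                - ∏ μ ∈ ({u, v} : Finset (Fin n))ᶜ,
                    Real.cos (2 * γ * (c' s(μ, u) - c' s(μ, v)))) : ℝ) : ℂ) := by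
  simp only [isQAOAOutput_iff hΓ γ β hP]
  refine ⟨⟨_, rfl, fun _ h => h⟩, ?_⟩
  rintro _ rfl
  rw [← ht]
  have hlin (ρ : Operator n) : expectation (couplingOp c) ρ =
      ∑ u : Fin n, ∑ v ∈ Finset.Ioi u,
        (c s(u, v) : ℂ) * expectation (sigmaZ u * sigmaZ v) ρ := by
    simp only [expectation, couplingOp, Finset.sum_mul, Matrix.trace_sum, smul_mul_assoc,
      Matrix.trace_smul, smul_eq_mul]
  rw [hlin, ← Finset.sum_sub_distrib, Complex.ofReal_sum]
  refine Finset.sum_congr rfl fun u _ => ?_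
  rw [← Finset.sum_sub_distrib, Complex.ofReal_sum]
  refine Finset.sum_congr rfl fun v hv => ?_
  rw [expectation_sigmaZ_mul_sigmaZ_mixer_dephasedState Γ γ t β c' (Finset.mem_Ioi.mp hv).ne,
    ← Complex.ofReal_mul]
  congr 1
  ring

end
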